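/- Let $\ell^2(\mathbb N)$ ($\mathbb N=\{0,1,2,\dots\}$) have canonical orthonormal basis $|n\rangle$, $n\ge 0$ (the eigenvectors of the quantum harmonic oscillator $\mathfrak a^\dagger\mathfrak a$), where $\mathfrak a|n\rangle=\sqrt n\,|n-1\rangle$ and $\mathfrak a^\dagger|n\rangle=\sqrt{n+1}\,|n+1\rangle$. Let $\mathcal A=\mathcal S(\mathbb N^2)$ be the $*$-algebra of rapid decay matrices $(a_{mn})_{m,n\ge 0}$, that is $\sup_{m,n}(m+1)^k(n+1)^k|a_{mn}|<\infty$ for all $k\in\mathbb N$, acting on $\ell^2(\mathbb N)$ and diagonally on $\ell^2(\mathbb N)\otimes\mathbb C^2$. For $\theta>0$ let $D$ be the Dirac operator $$D=\sqrt{\frac{2}{\theta}}\begin{pmatrix}0&\mathfrak a\\ \mathfrak a^\dagger&0\end{pmatrix}$$ on $\ell^2(\mathbb N)\otimes\mathbb C^2$, with domain the vectors $(v_1,v_2)$ such that $\mathfrak a v_i$ and $\mathfrak a^\dagger v_i$ are square summable for $i=1,2$. On the states of $\mathcal A$ (that is, of its $C^*$-closure) consider the spectral distance $$d_D(\varphi,\varphi')=\sup\{\varphi(a)-\varphi'(a)\,:\,a=a^*\in\mathcal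 A,\ \|[D,a]\|\le 1\}\in[0,\infty].$$ For $m\ge 0$ let $\Psi_m^\theta$ be the state $\Psi_m^\theta(a)=\langle m|a|m\rangle=a_{mm}$, and let $X_\theta=\{\Psi_m^\theta:m\ge 0\}$ with the distance $d_D$. Let $X_0=[0,\infty)$ with the Euclidean distance. **Proposition.** (i) For every $\theta>0$, $X_\theta$ is a metric space (on it $d_D$ is finite and vanishes only between equal points), and an isometric embedding $f_\theta:X_\theta\to X_0$ is given by $$f_\theta(\Psi_m^\theta)=x_m^\theta:=\sum_{k=1}^m\sqrt{\frac{\theta}{2k}}\qquad(x_0^\theta=0).$$ (ii) As $\theta\to0^+$, $X_\theta\to X_0$ in the Gromov–Hausdorff distance: $d_{GH}(X_\theta,X_0)\to 0$, where $d_{GH}(X,Y)\in[0,\infty]$ is the infimum, over all metric spaces $Z$ and all isometric embeddings of $X$ and $Y$ into $Z$, of the Hausdorff distance in $Z$ between the images of $X$ and $Y$. -/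

import Mathlib

open Filter Topology
open scoped ENNReal InnerProductSpace

noncomputable section

/-! ### States and the spectral distance of a triple `(𝒜, H, D)` -/

section SpectralDistance

variable {H₀ H : Type*}
  [NormedAddCommGroup H₀] [InnerProductSpace ℂ H₀] [CompleteSpace H₀]
  [NormedAddCommGroup H] [InnerProductSpace ℂ H] [CompleteSpace H]

/-- A state of a pre-C*-algebra `𝒜` of bounded operators is a state of its C*-closure: a positive
linear functional of norm one on the norm closure of `𝒜`. -/
structure PreCStarState (𝒜 : NonUnitalStarSubalgebra ℂ (H₀ →L[ℂ] H₀)) where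
  toCLM : 𝒜.topologicalClosure →L[ℂ] ℂ
  nonneg' : ∀ a : 𝒜.topologicalClosure, ∃ r : ℝ, 0 ≤ r ∧ toCLM (star a * a) = (r : ℂ)
  norm_eq_one' : ‖toCLM‖ = 1

theorem norm_eq_one_of_attained {𝒜 : NonUnitalStarSubalgebra ℂ (H₀ →L[ℂ] H₀)}
    (f : 𝒜.topologicalClosure →L[ℂ] ℂ) (hf : ∀ a : 𝒜.topologicalClosure, ‖f a‖ ≤ ‖a.1‖)
    (x : 𝒜.topologicalClosure) (hx : ‖x.1‖ = 1) (hfx : f x = 1) : ‖f‖ = 1 := by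
  refine le_antisymm (f.opNorm_le_bound zero_le_one fun a => ?_) ?_
  · rw [one_mul]; exact hf a
  · have h := f.le_opNorm x
    have h2 : ‖x‖ = 1 := hx
    rwa [hfx, h2, norm_one, mul_one] at h

/-- The value `φ(a)` of a state on an element of the pre-C*-algebra itself. -/
def PreCStarState.eval {𝒜 : NonUnitalStarSubalgebra ℂ (H₀ →L[ℂ] H₀)} (φ : PreCStarState 𝒜)
    (a : 𝒜) : ℂ :=
  φ.toCLM ⟨a.1, 𝒜.le_topologicalClosure a.2⟩

/-- `‖[D, T]‖ ≤ 1` for a bounded operator `T` and an unbounded operator `D`: the operator `T`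
preserves the domain of `D`, and the commutator, defined on `Dom D`, is bounded by one. -/
def CommutatorNormLEOne (D : H →ₗ.[ℂ] H) (T : H →L[ℂ] H) : Prop :=
  ∀ v : D.domain, ∃ h : T v ∈ D.domain, ‖D ⟨T v, h⟩ - T (D v)‖ ≤ ‖(v : H)‖

/-- The spectral (Connes) distance: the supremum of `φ(a) - φ'(a)` over the self-adjoint `a ∈ 𝒜`
with `‖[D, π(a)]‖ ≤ 1`. The values `φ(a)` are real for such `a`, and `a = 0` is allowed, so that
the supremum is an element of `[0, ∞]`. -/
def spectralEDist {𝒜 : NonUnitalStarSubalgebra ℂ (H₀ →L[ℂ] H₀)}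
    (π : 𝒜 →⋆ₙₐ[ℂ] (H →L[ℂ] H)) (D : H →ₗ.[ℂ] H) (φ φ' : PreCStarState 𝒜) : ℝ≥0∞ :=
  ⨆ (a : 𝒜) (_ : IsSelfAdjoint a) (_ : CommutatorNormLEOne D (π a)),
    ENNReal.ofReal (φ.eval a - φ'.eval a).re

/-- The states of `𝒜`, to be equipped with the spectral distance given by `π` and `D`. -/
@[nolint unusedArguments]
def SpectralStateSpace {𝒜 : NonUnitalStarSubalgebra ℂ (H₀ →L[ℂ] H₀)}
    (_π : 𝒜 →⋆ₙₐ[ℂ] (H →L[ℂ] H)) (_D : H →ₗ.[ℂ] H) :=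
  PreCStarState 𝒜

set_option linter.unusedSectionVars false in
theorem CommutatorNormLEOne.neg {D : H →ₗ.[ℂ] H} {T : H →L[ℂ] H}
    (h : CommutatorNormLEOne D T) : CommutatorNormLEOne D (-T) := by
  intro v
  obtain ⟨h1, h2⟩ := h v
  refine ⟨by simpa using D.domain.neg_mem h1, ?_⟩
  have e : (⟨(-T) v, by simpa using D.domain.neg_mem h1⟩ : D.domain) = -⟨T v, h1⟩ := by
    ext; simp
  rw [e, D.map_neg]
  have : -D ⟨T v, h1⟩ - (-T) (D v) = -(D ⟨T v, h1⟩ - T (D v)) := by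
    simp only [neg_apply]; abel
  rw [this, norm_neg]
  exact h2

theorem PreCStarState.eval_neg {𝒜 : NonUnitalStarSubalgebra ℂ (H₀ →L[ℂ] H₀)}
    (φ : PreCStarState 𝒜) (a : 𝒜) : φ.eval (-a) = -φ.eval a := by
  unfold PreCStarState.eval
  rw [← map_neg]
  rfl

theorem spectralEDist_comm_le {𝒜 : NonUnitalStarSubalgebra ℂ (H₀ →L[ℂ] H₀)}
    (π : 𝒜 →⋆ₙₐ[ℂ] (H →L[ℂ] H)) (D : H →ₗ.[ℂ] H) (φ φ' : PreCStarState 𝒜) :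
    spectralEDist π D φ φ' ≤ spectralEDist π D φ' φ := by
  refine iSup_le fun a => iSup_le fun ha => iSup_le fun hc => ?_
  have hc' : CommutatorNormLEOne D (π (-a)) := by rw [map_neg]; exact hc.neg
  refine le_trans (le_of_eq ?_)
    (le_iSup_of_le (-a) (le_iSup_of_le ha.neg (le_iSup_of_le hc' le_rfl)))
  rw [PreCStarState.eval_neg, PreCStarState.eval_neg]
  congr 2
  ring

instance {𝒜 : NonUnitalStarSubalgebra ℂ (H₀ →L[ℂ] H₀)}
    (π : 𝒜 →⋆ₙₐ[ℂ] (H →L[ℂ] H)) (D : H →ₗ.[ℂ] H) :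
    PseudoEMetricSpace (SpectralStateSpace π D) where
  edist φ φ' := spectralEDist π D φ φ'
  edist_self φ := by
    simp [spectralEDist]
  edist_comm φ φ' :=
    le_antisymm (spectralEDist_comm_le π D φ φ') (spectralEDist_comm_le π D φ' φ)
  edist_triangle φ φ' φ'' := by
    refine iSup_le fun a => iSup_le fun ha => iSup_le fun hc => ?_
    have e : (PreCStarState.eval φ a - PreCStarState.eval φ'' a).re
        = (PreCStarState.eval φ a - PreCStarState.eval φ' a).re
          + (PreCStarState.eval φ' a - PreCStarState.eval φ'' a).re := by
      simp
    rw [e]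
    refine ENNReal.ofReal_add_le.trans (add_le_add ?_ ?_)
    · exact le_iSup_of_le a (le_iSup_of_le ha (le_iSup_of_le hc le_rfl))
    · exact le_iSup_of_le a (le_iSup_of_le ha (le_iSup_of_le hc le_rfl))

end SpectralDistance

/-! ### Gromov–Hausdorff distance of arbitrary (not necessarily compact) metric spaces -/

/-- The Gromov–Hausdorff distance: the infimum, over all metric spaces `Z` and all isometric
embeddings of `X` and `Y` into `Z`, of the Hausdorff distance in `Z` of the two images. -/
def gromovHausdorffEDist (X Y : Type) [PseudoEMetricSpace X] [PseudoEMetricSpace Y] : ℝ≥0∞ :=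
  ⨅ (Z : Type) (_ : MetricSpace Z) (f : X → Z) (g : Y → Z) (_ : Isometry f) (_ : Isometry g),
    Metric.hausdorffEDist (Set.range f) (Set.range g)

/-! ### The Schrödinger spectral triple of the Moyal plane -/

namespace Moyal

/-- The Hilbert space `ℓ²(ℕ)`. -/
abbrev L2 : Type := lp (fun _ : ℕ => ℂ) 2

/-- The basis vector `|n⟩` of `ℓ²(ℕ)`, the `n`-th eigenvector of the harmonic oscillator. -/
def ket (n : ℕ) : L2 := lp.single 2 n (1 : ℂ)

/-- The matrix coefficient `⟨m| T |n⟩` of a bounded operator. -/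
def coeff (T : L2 →L[ℂ] L2) (m n : ℕ) : ℂ := T (ket n) m

/-- Rapid decay of an infinite matrix. -/
def IsRapidDecay (A : ℕ → ℕ → ℂ) : Prop :=
  ∀ k : ℕ, ∃ C : ℝ, ∀ m n : ℕ, ((m : ℝ) + 1) ^ k * ((n : ℝ) + 1) ^ k * ‖A m n‖ ≤ C

theorem inner_ket (n : ℕ) (v : L2) : ⟪ket n, v⟫_ℂ = v n := by
  simp [ket, lp.inner_single_left]

theorem norm_ket (n : ℕ) : ‖ket n‖ = 1 := by
  simp [ket, lp.norm_single]

theorem ket_apply (m n : ℕ) : (ket n : ℕ → ℂ) m = if m = n then 1 else 0 := by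
  simp [ket, Pi.single_apply]

theorem coeff_eq_inner (T : L2 →L[ℂ] L2) (m n : ℕ) : coeff T m n = ⟪ket m, T (ket n)⟫_ℂ :=
  (inner_ket _ _).symm

theorem coeff_star (T : L2 →L[ℂ] L2) (m n : ℕ) :
    coeff (star T) m n = starRingEnd ℂ (coeff T n m) := by
  rw [coeff_eq_inner, coeff_eq_inner, ContinuousLinearMap.star_eq_adjoint,
    ContinuousLinearMap.adjoint_inner_right, inner_conj_symm]

theorem IsRapidDecay.star {T : L2 →L[ℂ] L2} (h : IsRapidDecay (coeff T)) :
    IsRapidDecay (coeff (star T)) := by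
  intro k
  obtain ⟨C, hC⟩ := h k
  refine ⟨C, fun m n => ?_⟩
  rw [coeff_star, RCLike.norm_conj, mul_comm (((m : ℝ) + 1) ^ k)]
  exact hC n m

theorem IsRapidDecay.column {T : L2 →L[ℂ] L2} (h : IsRapidDecay (coeff T)) (k : ℕ) :
    ∃ C : ℝ, ∀ n : ℕ, ((n : ℝ) + 1) ^ k * ‖T (ket n)‖ ≤ C := by
  obtain ⟨C, hC⟩ := h (k + 1)
  have hs : Summable fun i : ℕ => (C / ((i : ℝ) + 1)) ^ 2 := by
    have h2 : Summable fun i : ℕ => 1 / ((i : ℝ) ^ 2) :=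
      Real.summable_one_div_nat_pow.2 one_lt_two
    have h3 := ((summable_nat_add_iff 1).2 h2).mul_left (C ^ 2)
    refine h3.congr fun i => ?_
    push_cast
    rw [div_pow]
    ring
  refine ⟨√(∑' i : ℕ, (C / ((i : ℝ) + 1)) ^ 2), fun n => ?_⟩
  have hn : (0 : ℝ) ≤ ((n : ℝ) + 1) ^ k := by positivity
  have e : ((n : ℝ) + 1) ^ k * ‖T (ket n)‖ = ‖((((n : ℝ) + 1) ^ k : ℝ) : ℂ) • T (ket n)‖ := by
    rw [norm_smul, Complex.norm_real, Real.norm_of_nonneg hn]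
  rw [e]
  refine lp.norm_le_of_forall_sum_le (by norm_num) (Real.sqrt_nonneg _) fun s => ?_
  have e2 : (2 : ℝ≥0∞).toReal = ((2 : ℕ) : ℝ) := by norm_num
  rw [e2]
  simp only [Real.rpow_natCast]
  rw [Real.sq_sqrt (tsum_nonneg fun i => sq_nonneg _)]
  refine le_trans (Finset.sum_le_sum fun i _ => ?_) (hs.sum_le_tsum s fun i _ => sq_nonneg _)
  refine pow_le_pow_left₀ (norm_nonneg _) ?_ 2
  rw [lp.coeFn_smul, Pi.smul_apply, norm_smul, Complex.norm_real, Real.norm_of_nonneg hn,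
    le_div_iff₀ (by positivity)]
  refine le_trans ?_ (hC i n)
  have h1 : ((n : ℝ) + 1) ^ k ≤ ((n : ℝ) + 1) ^ (k + 1) :=
    pow_le_pow_right₀ (by linarith [n.cast_nonneg (α := ℝ)]) (Nat.le_succ k)
  have h2 : ((i : ℝ) + 1) ≤ ((i : ℝ) + 1) ^ (k + 1) :=
    le_self_pow₀ (by linarith [i.cast_nonneg (α := ℝ)]) (Nat.succ_ne_zero k)
  have h3 : ((i : ℝ) + 1) * ((n : ℝ) + 1) ^ k
      ≤ ((i : ℝ) + 1) ^ (k + 1) * ((n : ℝ) + 1) ^ (k + 1) := by gcongr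
  calc ((n : ℝ) + 1) ^ k * ‖T (ket n) i‖ * ((i : ℝ) + 1)
      = ((i : ℝ) + 1) * ((n : ℝ) + 1) ^ k * ‖T (ket n) i‖ := by ring
    _ ≤ _ := mul_le_mul_of_nonneg_right h3 (norm_nonneg _)

theorem IsRapidDecay.mul {S T : L2 →L[ℂ] L2} (hS : IsRapidDecay (coeff S))
    (hT : IsRapidDecay (coeff T)) : IsRapidDecay (coeff (S * T)) := by
  intro k
  obtain ⟨A, hA⟩ := hS.star.column k
  obtain ⟨B, hB⟩ := hT.column k
  refine ⟨A * B, fun m n => ?_⟩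
  have e : coeff (S * T) m n = ⟪(Star.star S) (ket m), T (ket n)⟫_ℂ := by
    rw [coeff_eq_inner, ContinuousLinearMap.star_eq_adjoint,
      ContinuousLinearMap.adjoint_inner_left]
    rfl
  rw [e]
  have hm : (0 : ℝ) ≤ ((m : ℝ) + 1) ^ k := by positivity
  have hn : (0 : ℝ) ≤ ((n : ℝ) + 1) ^ k := by positivity
  calc ((m : ℝ) + 1) ^ k * ((n : ℝ) + 1) ^ k * ‖⟪(Star.star S) (ket m), T (ket n)⟫_ℂ‖
      ≤ ((m : ℝ) + 1) ^ k * ((n : ℝ) + 1) ^ k * (‖(Star.star S) (ket m)‖ * ‖T (ket n)‖) := by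
        gcongr
        exact norm_inner_le_norm _ _
    _ = (((m : ℝ) + 1) ^ k * ‖(Star.star S) (ket m)‖)
          * (((n : ℝ) + 1) ^ k * ‖T (ket n)‖) := by ring
    _ ≤ A * B := by
        refine mul_le_mul (hA m) (hB n) (by positivity) (le_trans (by positivity) (hA m))

/-- The algebra `𝒮(ℕ²)` of rapid decay matrices, as operators on `ℓ²(ℕ)`. -/
def rapidDecayAlgebra : NonUnitalStarSubalgebra ℂ (L2 →L[ℂ] L2) where
  carrier := {T | IsRapidDecay (coeff T)}
  zero_mem' := fun k => ⟨0, fun m n => by simp [coeff]⟩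
  add_mem' := by
    intro S T hS hT k
    obtain ⟨A, hA⟩ := hS k
    obtain ⟨B, hB⟩ := hT k
    refine ⟨A + B, fun m n => ?_⟩
    have e : coeff (S + T) m n = coeff S m n + coeff T m n := by simp [coeff]
    rw [e]
    refine le_trans (mul_le_mul_of_nonneg_left (norm_add_le _ _) (by positivity)) ?_
    rw [mul_add]
    exact add_le_add (hA m n) (hB m n)
  mul_mem' := fun hS hT => IsRapidDecay.mul hS hT
  smul_mem' := by
    intro c T hT k
    obtain ⟨A, hA⟩ := hT k
    refine ⟨‖c‖ * A, fun m n => ?_⟩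
    have e : coeff (c • T) m n = c * coeff T m n := by simp [coeff]
    rw [e, norm_mul, mul_left_comm]
    exact mul_le_mul_of_nonneg_left (hA m n) (norm_nonneg c)
  star_mem' := fun hT => IsRapidDecay.star hT

/-- The Hilbert space `ℓ²(ℕ) ⊗ ℂ²`, written as pairs `(v₁, v₂)`. -/
abbrev Spinor : Type := WithLp 2 (L2 × L2)

/-- The diagonal action `(v₁, v₂) ↦ (T v₁, T v₂)` of a bounded operator on `ℓ²(ℕ) ⊗ ℂ²`. -/
def diagCLM (T : L2 →L[ℂ] L2) : Spinor →L[ℂ] Spinor :=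
  ((WithLp.prodContinuousLinearEquiv 2 ℂ L2 L2).symm : L2 × L2 →L[ℂ] Spinor) ∘L
    (T.prodMap T) ∘L (WithLp.prodContinuousLinearEquiv 2 ℂ L2 L2 : Spinor →L[ℂ] L2 × L2)

theorem diagCLM_apply (T : L2 →L[ℂ] L2) (v : Spinor) :
    diagCLM T v = WithLp.toLp 2 (T v.fst, T v.snd) := rfl

/-- The representation of `𝒮(ℕ²)` on `ℓ²(ℕ) ⊗ ℂ²`. -/
def diagRep : rapidDecayAlgebra →⋆ₙₐ[ℂ] (Spinor →L[ℂ] Spinor) where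
  toFun T := diagCLM T
  map_smul' c T := rfl
  map_zero' := rfl
  map_add' S T := rfl
  map_mul' S T := rfl
  map_star' T := by
    rw [ContinuousLinearMap.star_eq_adjoint, ContinuousLinearMap.eq_adjoint_iff]
    intro v w
    have h : ((star T : rapidDecayAlgebra) : L2 →L[ℂ] L2)
        = ContinuousLinearMap.adjoint (T : L2 →L[ℂ] L2) := rfl
    rw [diagCLM_apply, diagCLM_apply, WithLp.prod_inner_apply, WithLp.prod_inner_apply, h]
    simp only [ContinuousLinearMap.adjoint_inner_left]
    rfl

/-- The annihilation operator `𝔞 |n⟩ = √n |n-1⟩`, on arbitrary sequences. -/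
def annihilation : (ℕ → ℂ) →ₗ[ℂ] (ℕ → ℂ) where
  toFun v n := (√((n : ℝ) + 1) : ℂ) * v (n + 1)
  map_add' v w := by ext n; simp [mul_add]
  map_smul' c v := by ext n; simp [mul_left_comm]

/-- The creation operator `𝔞† |n⟩ = √(n+1) |n+1⟩`, on arbitrary sequences. -/
def creation : (ℕ → ℂ) →ₗ[ℂ] (ℕ → ℂ) where
  toFun v n := (√(n : ℝ) : ℂ) * v (n - 1)
  map_add' v w := by ext n; simp [mul_add]
  map_smul' c v := by ext n; simp [mul_left_comm]

/-- The basis vectors are the eigenvectors of the harmonic oscillator: `𝔞† 𝔞 |n⟩ = n |n⟩`. -/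
theorem creation_annihilation_ket (n : ℕ) :
    creation (annihilation (ket n)) = (n : ℂ) • (ket n : ℕ → ℂ) := by
  ext m
  rcases m with _ | m
  · by_cases h : (0 : ℕ) = n
    · simp [creation, ← h]
    · simp [creation, ket_apply, h]
  · by_cases h : m + 1 = n
    · subst h
      have h2 : (√((m : ℝ) + 1) : ℂ) * (√((m : ℝ) + 1) : ℂ) = (m : ℂ) + 1 := by
        rw [← Complex.ofReal_mul, Real.mul_self_sqrt (by positivity)]
        push_cast
        ring
      simp [creation, annihilation, ket_apply, h2]
    · simp [creation, annihilation, ket_apply, h]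

/-- The domain of the Dirac operator: the pairs `(v₁, v₂)` such that `𝔞 vᵢ` and `𝔞† vᵢ` are square
summable for `i = 1, 2`. -/
def diracDomain : Submodule ℂ Spinor where
  carrier := {v | (Memℓp (annihilation v.fst) 2 ∧ Memℓp (creation v.fst) 2) ∧
    (Memℓp (annihilation v.snd) 2 ∧ Memℓp (creation v.snd) 2)}
  zero_mem' := by
    have h : ((0 : L2) : ℕ → ℂ) = 0 := rfl
    simp only [Set.mem_ofPred_eq, WithLp.zero_fst, WithLp.zero_snd, h, map_zero]
    exact ⟨⟨zero_memℓp, zero_memℓp⟩, ⟨zero_memℓp, zero_memℓp⟩⟩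
  add_mem' := by
    rintro v w ⟨⟨h1, h2⟩, h3, h4⟩ ⟨⟨h1', h2'⟩, h3', h4'⟩
    simp only [Set.mem_ofPred_eq, WithLp.add_fst, WithLp.add_snd, lp.coeFn_add, map_add]
    exact ⟨⟨h1.add h1', h2.add h2'⟩, h3.add h3', h4.add h4'⟩
  smul_mem' := by
    rintro c v ⟨⟨h1, h2⟩, h3, h4⟩
    simp only [Set.mem_ofPred_eq, WithLp.smul_fst, WithLp.smul_snd, lp.coeFn_smul, map_smul]
    exact ⟨⟨h1.const_smul c, h2.const_smul c⟩, h3.const_smul c, h4.const_smul c⟩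

/-- The Dirac operator `D (v₁, v₂) = √(2/θ) (𝔞 v₂, 𝔞† v₁)`. -/
def dirac (θ : ℝ) : Spinor →ₗ.[ℂ] Spinor where
  domain := diracDomain
  toFun :=
    { toFun := fun v => (√(2 / θ) : ℂ) •
        (WithLp.toLp 2 ((⟨annihilation v.1.snd, v.2.2.1⟩ : L2), (⟨creation v.1.fst, v.2.1.2⟩ : L2)))
      map_add' := by
        intro v w
        rw [← smul_add, ← WithLp.toLp_add, Prod.mk_add_mk]
        congr 3
        · ext1; exact map_add annihilation _ _
        · ext1; exact map_add creation _ _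
      map_smul' := by
        intro c v
        rw [RingHom.id_apply, smul_comm c, ← WithLp.toLp_smul, Prod.smul_mk]
        congr 3
        · ext1; exact map_smul annihilation _ _
        · ext1; exact map_smul creation _ _ }

/-- The rank one projection `|m⟩⟨m|`. -/
def ketBra (m : ℕ) : L2 →L[ℂ] L2 := (innerSL ℂ (ket m)).smulRight (ket m)

theorem norm_ketBra (m : ℕ) : ‖ketBra m‖ = 1 := by
  rw [ketBra, ContinuousLinearMap.norm_smulRight_apply, innerSL_apply_norm, norm_ket, mul_one]

theorem coeff_ketBra (m i j : ℕ) :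
    coeff (ketBra m) i j = (if m = j then 1 else 0) * (if i = m then 1 else 0) := by
  simp only [coeff, ketBra, ContinuousLinearMap.smulRight_apply, innerSL_apply_apply, inner_ket,
    lp.coeFn_smul, Pi.smul_apply, smul_eq_mul, ket_apply]

theorem ketBra_mem (m : ℕ) : ketBra m ∈ rapidDecayAlgebra := by
  intro k
  refine ⟨((m : ℝ) + 1) ^ k * ((m : ℝ) + 1) ^ k, fun i j => ?_⟩
  rw [coeff_ketBra]
  by_cases hj : m = j
  · by_cases hi : i = m
    · subst hi; subst hj; simp
    · simp only [hi, if_false, mul_zero, norm_zero]; positivity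
  · simp only [hj, if_false, zero_mul, mul_zero, norm_zero]; positivity

theorem norm_coeff_self_le (m : ℕ) (a : rapidDecayAlgebra.topologicalClosure) :
    ‖coeff a.1 m m‖ ≤ ‖a.1‖ := by
  rw [coeff_eq_inner]
  refine (norm_inner_le_norm _ _).trans ?_
  rw [norm_ket, one_mul]
  refine (a.1.le_opNorm _).trans ?_
  rw [norm_ket, mul_one]

/-- The functional `a ↦ a_mm = ⟨m| a |m⟩`. -/
def diagFunctional (m : ℕ) : rapidDecayAlgebra.topologicalClosure →L[ℂ] ℂ :=
  LinearMap.mkContinuous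
    { toFun := fun a => coeff a.1 m m
      map_add' := fun a b => by simp [coeff]
      map_smul' := fun c a => by simp [coeff] } 1
    (fun a => (norm_coeff_self_le m a).trans (le_of_eq (one_mul _).symm))

theorem diagFunctional_apply (m : ℕ) (a : rapidDecayAlgebra.topologicalClosure) :
    diagFunctional m a = coeff a.1 m m := rfl

/-- The state `Ψ_m(a) = a_mm` of the `m`-th eigenvector of the harmonic oscillator. -/
def eigenstate (m : ℕ) : PreCStarState rapidDecayAlgebra where
  toCLM := diagFunctional m
  nonneg' := by
    intro a
    refine ⟨‖a.1 (ket m)‖ ^ 2, sq_nonneg _, ?_⟩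
    rw [diagFunctional_apply, coeff_eq_inner]
    change ⟪ket m, (star a.1) (a.1 (ket m))⟫_ℂ = _
    rw [ContinuousLinearMap.star_eq_adjoint, ContinuousLinearMap.adjoint_inner_right,
      inner_self_eq_norm_sq_to_K]
    simp
  norm_eq_one' := by
    refine norm_eq_one_of_attained _ (norm_coeff_self_le m)
      ⟨ketBra m, rapidDecayAlgebra.le_topologicalClosure (ketBra_mem m)⟩ ?_ ?_
    · exact norm_ketBra m
    · rw [diagFunctional_apply, coeff_ketBra]
      simp

/-- The space of all states of the Moyal algebra with the spectral distance of the Schrödinger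
spectral triple with parameter `θ`. -/
abbrev States (θ : ℝ) : Type := SpectralStateSpace diagRep (dirac θ)

/-- The space `X_θ` of the eigenstates `Ψ_m`, with the spectral distance. -/
abbrev EigenstateSpace (θ : ℝ) : Type :=
  {φ : States θ // ∃ m : ℕ, φ = (eigenstate m : States θ)}

/-- The point `Ψ_m^θ` of `X_θ`. -/
def Psi (θ : ℝ) (m : ℕ) : EigenstateSpace θ := ⟨eigenstate m, m, rfl⟩

end Moyal

end

/-! Only the diagonal of `a` matters. The entry of `[D, a]` that takes `|k⟩` in the first component
to `|k+1⟩` in the second is `√(2/θ) √(k+1) (a_kk - a_{k+1,k+1})`, so `‖[D, a]‖ ≤ 1` forces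
consecutive diagonal entries to differ by at most `√(θ/(2(k+1)))`, which is the gap between
consecutive positions. Telescoping bounds the distance above by `x_n - x_m`
(`norm_coeff_sub_coeff_le`). Conversely, a diagonal `a` has a commutator made of two weighted
shifts, which is a contraction as soon as the gaps obey the same bound
(`commutatorNormLEOne_diagonal`). A truncated diagonal matrix therefore attains `x_n - x_m`, which
gives `edist_Psi`.

For the limit, the positions start at 0, tend to infinity and have gaps at most `√θ`. Hence they
form a `√θ`-net of the half-line, and the Hausdorff distance inside `ℝ` is at most `√θ`. -/

namespace Moyal

/-! ### Positions on the half-line -/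

/-- The point `x_m^θ` of the half-line. -/
noncomputable def position (θ : ℝ) (m : ℕ) : ℝ := ∑ k ∈ Finset.Icc 1 m, √(θ / (2 * (k : ℝ)))

theorem position_succ (θ : ℝ) (m : ℕ) :
    position θ (m + 1) = position θ m + √(θ / (2 * ((m : ℝ) + 1))) := by
  rw [position, Finset.sum_Icc_succ_top (by omega)]
  push_cast
  rfl

theorem position_zero (θ : ℝ) : position θ 0 = 0 := by simp [position]

theorem position_strictMono {θ : ℝ} (hθ : 0 < θ) : StrictMono (position θ) := by
  refine strictMono_nat_of_lt_succ fun m => ?_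
  rw [position_succ]
  have : 0 < √(θ / (2 * ((m : ℝ) + 1))) := Real.sqrt_pos.2 (by positivity)
  linarith

theorem position_nonneg (θ : ℝ) (m : ℕ) : 0 ≤ position θ m :=
  Finset.sum_nonneg fun _ _ => Real.sqrt_nonneg _

/-- The gap after `x_m` is the inverse of the matrix entry of `D` between levels `m` and `m + 1`;
both bounds for the distance rest on this. -/
theorem sqrt_mul_sqrt_mul_sqrt {θ : ℝ} (hθ : 0 < θ) (m : ℕ) :
    √(2 / θ) * √((m : ℝ) + 1) * √(θ / (2 * ((m : ℝ) + 1))) = 1 := by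
  rw [← Real.sqrt_mul (by positivity), ← Real.sqrt_mul (by positivity), Real.sqrt_eq_one]
  field_simp

theorem sqrt_gap_le {θ : ℝ} (hθ : 0 < θ) (m : ℕ) : √(θ / (2 * ((m : ℝ) + 1))) ≤ √θ := by
  refine Real.sqrt_le_sqrt (div_le_self hθ.le ?_)
  linarith [m.cast_nonneg (α := ℝ)]

/-- The last of the `m` summands is the smallest, so the sum is at least `m √(θ/(2m))`, which grows
like `√m`. The constant `√θ / 2` is not sharp. -/
theorem tendsto_position_atTop {θ : ℝ} (hθ : 0 < θ) : Tendsto (position θ) atTop atTop := by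
  have h : ∀ m : ℕ, √θ / 2 * √(m : ℝ) ≤ position θ m := by
    intro m
    rcases Nat.eq_zero_or_pos m with rfl | hm
    · simp [position_zero]
    have hm' : (0 : ℝ) < m := by exact_mod_cast hm
    have e : ∀ k ∈ Finset.Icc 1 m, √(θ / (2 * (m : ℝ))) ≤ √(θ / (2 * (k : ℝ))) := by
      intro k hk
      rw [Finset.mem_Icc] at hk
      have h1 : (1 : ℝ) ≤ k := by exact_mod_cast hk.1
      have h2 : (k : ℝ) ≤ m := by exact_mod_cast hk.2
      gcongr
    have h3 := Finset.card_nsmul_le_sum _ _ _ e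
    rw [Nat.card_Icc, Nat.add_sub_cancel, nsmul_eq_mul] at h3
    refine le_trans ?_ h3
    have e1 : (m : ℝ) = √(m : ℝ) * √(m : ℝ) := (Real.mul_self_sqrt hm'.le).symm
    have e2 : √θ / 2 = √(θ / 4) := by
      rw [Real.sqrt_div hθ.le, show (4 : ℝ) = 2 ^ 2 by norm_num, Real.sqrt_sq (by norm_num)]
    have e3 : √(θ / 4) ≤ √(m : ℝ) * √(θ / (2 * (m : ℝ))) := by
      rw [← Real.sqrt_mul hm'.le]
      refine Real.sqrt_le_sqrt ?_
      rw [show (m : ℝ) * (θ / (2 * m)) = θ / 2 by field_simp]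
      linarith
    calc √θ / 2 * √(m : ℝ) ≤ √(m : ℝ) * √(θ / (2 * (m : ℝ))) * √(m : ℝ) := by
          rw [e2]; gcongr
      _ = √(m : ℝ) * √(m : ℝ) * √(θ / (2 * (m : ℝ))) := by ring
      _ = (m : ℝ) * √(θ / (2 * (m : ℝ))) := by rw [← e1]
  refine tendsto_atTop_mono h (Tendsto.const_mul_atTop (by positivity) ?_)
  exact Real.tendsto_sqrt_atTop.comp tendsto_natCast_atTop_atTop

/-! ### Diagonal operators and their commutators with `D` -/

/-- Used to bound weighted shifts. Injectivity is asked only on the support of `w` because `k ↦ k -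
1` identifies 0 and 1 in `ℕ`. -/
theorem norm_le_of_norm_apply_le {w v : L2} (g : ℕ → ℕ) (hg : Set.InjOn g {k | w k ≠ 0})
    (h : ∀ k, w k ≠ 0 → ‖w k‖ ≤ ‖v (g k)‖) : ‖w‖ ≤ ‖v‖ := by
  classical
  refine lp.norm_le_of_forall_sum_le (by norm_num) (norm_nonneg _) fun s => ?_
  have h2 : (0 : ℝ) < (2 : ℝ≥0∞).toReal := by norm_num
  have hs : ∑ k ∈ s with w k ≠ 0, ‖w k‖ ^ (2 : ℝ≥0∞).toReal
      = ∑ k ∈ s, ‖w k‖ ^ (2 : ℝ≥0∞).toReal := by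
    refine Finset.sum_filter_of_ne fun k _ hk h0 => hk ?_
    rw [h0, norm_zero, Real.zero_rpow h2.ne']
  rw [← hs]
  refine le_trans (Finset.sum_le_sum (g := fun k => ‖v (g k)‖ ^ (2 : ℝ≥0∞).toReal)
    fun k hk => ?_) ?_
  · exact Real.rpow_le_rpow (norm_nonneg _) (h k (Finset.mem_filter.1 hk).2) h2.le
  · rw [← Finset.sum_image (s := s.filter fun k => w k ≠ 0) (g := g)
      (f := fun k => ‖v k‖ ^ (2 : ℝ≥0∞).toReal)]
    · exact lp.sum_rpow_le_norm_rpow h2 v _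
    · exact hg.mono fun k hk => (Finset.mem_filter.1 hk).2

/-- The finitely supported diagonal operator with entries `c k`, `k < n`. -/
noncomputable def diagonal (n : ℕ) (c : ℕ → ℝ) : L2 →L[ℂ] L2 :=
  ∑ k ∈ Finset.range n, (c k : ℂ) • ketBra k

theorem diagonal_mem (n : ℕ) (c : ℕ → ℝ) : diagonal n c ∈ rapidDecayAlgebra :=
  sum_mem fun k _ => SMulMemClass.smul_mem _ (ketBra_mem k)

theorem ketBra_apply (k : ℕ) (v : L2) (j : ℕ) :
    (ketBra k v : ℕ → ℂ) j = if k = j then v j else 0 := by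
  simp only [ketBra, ContinuousLinearMap.smulRight_apply, innerSL_apply_apply, inner_ket,
    lp.coeFn_smul, Pi.smul_apply, smul_eq_mul, ket_apply]
  by_cases h : k = j
  · simp [h]
  · simp [h, Ne.symm h]

theorem diagonal_apply {n : ℕ} {c : ℕ → ℝ} (hc : ∀ k, n ≤ k → c k = 0) (v : L2) (j : ℕ) :
    (diagonal n c v : ℕ → ℂ) j = (c j : ℂ) * v j := by
  simp only [diagonal, _root_.sum_apply, _root_.smul_apply,
    lp.coeFn_sum, Finset.sum_apply, lp.coeFn_smul, Pi.smul_apply, ketBra_apply, smul_eq_mul,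
    mul_ite, mul_zero, Finset.sum_ite_eq', Finset.mem_range]
  split_ifs with h
  · rfl
  · simp [hc j (not_lt.1 h)]

theorem isSelfAdjoint_ketBra (k : ℕ) : IsSelfAdjoint (ketBra k) := by
  rw [IsSelfAdjoint, ContinuousLinearMap.star_eq_adjoint, eq_comm,
    ContinuousLinearMap.eq_adjoint_iff]
  intro v w
  simp only [ketBra, ContinuousLinearMap.smulRight_apply, innerSL_apply_apply, inner_smul_left,
    inner_smul_right, inner_conj_symm]
  ring

theorem isSelfAdjoint_diagonal (n : ℕ) (c : ℕ → ℝ) : IsSelfAdjoint (diagonal n c) := by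
  rw [diagonal]
  exact isSelfAdjoint_sum _ fun k _ =>
    IsSelfAdjoint.smul (Complex.conj_ofReal _) (isSelfAdjoint_ketBra k)

theorem coeff_diagonal_self {n : ℕ} {c : ℕ → ℝ} (hc : ∀ k, n ≤ k → c k = 0) (m : ℕ) :
    coeff (diagonal n c) m m = c m := by
  rw [coeff, diagonal_apply hc, ket_apply]
  simp

theorem memℓp_of_eventually_zero (f : ℕ → ℂ) (n : ℕ) (h : ∀ k, n ≤ k → f k = 0) :
    Memℓp f 2 := by
  refine (memℓp_zero ((Set.finite_lt_nat n).subset fun k hk => ?_)).of_exponent_ge zero_le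
  by_contra h'
  exact hk (h k (not_lt.1 h'))

theorem diagCLM_diagonal_mem {n : ℕ} {c : ℕ → ℝ} (hc : ∀ k, n ≤ k → c k = 0) (v : Spinor) :
    diagCLM (diagonal n c) v ∈ diracDomain := by
  have ha (u : L2) : Memℓp (annihilation (diagonal n c u)) 2 :=
    memℓp_of_eventually_zero _ n fun k hk => by
      simp [annihilation, diagonal_apply hc, hc (k + 1) (by omega)]
  have hcr (u : L2) : Memℓp (creation (diagonal n c u)) 2 :=
    -- Creation moves the support up by one.
    memℓp_of_eventually_zero _ (n + 1) fun k hk => by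
      simp [creation, diagonal_apply hc, hc (k - 1) (by omega)]
  exact ⟨⟨ha _, hcr _⟩, ha _, hcr _⟩

/-- The commutator sends `v₂` to the first component by a weighted down-shift and `v₁` to the second
by a weighted up-shift. Up to sign the weights are `√(2/θ) √(k+1) (c (k+1) - c k)`, of modulus at
most one by `hgap`. -/
theorem commutatorNormLEOne_diagonal {θ : ℝ} (hθ : 0 < θ) {n : ℕ} {c : ℕ → ℝ}
    (hc : ∀ k, n ≤ k → c k = 0)
    (hgap : ∀ k : ℕ, |c (k + 1) - c k| ≤ √(θ / (2 * ((k : ℝ) + 1)))) :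
    CommutatorNormLEOne (dirac θ) (diagCLM (diagonal n c)) := by
  intro v
  refine ⟨diagCLM_diagonal_mem hc v, ?_⟩
  have key (k : ℕ) (z : ℂ) : ‖(√(2 / θ) : ℂ) * ((√((k : ℝ) + 1) : ℂ)
      * (((c (k + 1) - c k : ℝ) : ℂ) * z))‖ ≤ ‖z‖ := by
    rw [norm_mul, norm_mul, norm_mul, Complex.norm_real, Complex.norm_real, Complex.norm_real,
      Real.norm_of_nonneg (Real.sqrt_nonneg _), Real.norm_of_nonneg (Real.sqrt_nonneg _),
      Real.norm_eq_abs]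
    calc √(2 / θ) * (√((k : ℝ) + 1) * (|c (k + 1) - c k| * ‖z‖))
        = √(2 / θ) * √((k : ℝ) + 1) * |c (k + 1) - c k| * ‖z‖ := by ring
      _ ≤ √(2 / θ) * √((k : ℝ) + 1) * √(θ / (2 * ((k : ℝ) + 1))) * ‖z‖ := by
          gcongr; exact hgap k
      _ = ‖z‖ := by rw [sqrt_mul_sqrt_mul_sqrt hθ, one_mul]
  set w : Spinor := dirac θ ⟨diagCLM (diagonal n c) v, diagCLM_diagonal_mem hc v⟩
    - diagCLM (diagonal n c) (dirac θ v) with hw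
  have w1 (k : ℕ) : (w.fst : ℕ → ℂ) k = (√(2 / θ) : ℂ) * ((√((k : ℝ) + 1) : ℂ)
      * (((c (k + 1) - c k : ℝ) : ℂ) * v.1.snd (k + 1))) := by
    have e : (w.fst : ℕ → ℂ) k
        = (√(2 / θ) : ℂ) * ((√((k : ℝ) + 1) : ℂ) * (diagonal n c v.1.snd : ℕ → ℂ) (k + 1))
          - (diagonal n c (dirac θ v).fst : ℕ → ℂ) k := rfl
    have e2 : ((dirac θ v).fst : ℕ → ℂ) k
        = (√(2 / θ) : ℂ) * ((√((k : ℝ) + 1) : ℂ) * v.1.snd (k + 1)) := rfl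
    rw [e, diagonal_apply hc, diagonal_apply hc, e2]
    push_cast
    ring
  have w2 (k : ℕ) : (w.snd : ℕ → ℂ) k = (√(2 / θ) : ℂ) * ((√(k : ℝ) : ℂ)
      * (((c (k - 1) - c k : ℝ) : ℂ) * v.1.fst (k - 1))) := by
    have e : (w.snd : ℕ → ℂ) k
        = (√(2 / θ) : ℂ) * ((√(k : ℝ) : ℂ) * (diagonal n c v.1.fst : ℕ → ℂ) (k - 1))
          - (diagonal n c (dirac θ v).snd : ℕ → ℂ) k := rfl
    have e2 : ((dirac θ v).snd : ℕ → ℂ) k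
        = (√(2 / θ) : ℂ) * ((√(k : ℝ) : ℂ) * v.1.fst (k - 1)) := rfl
    rw [e, diagonal_apply hc, diagonal_apply hc, e2]
    push_cast
    ring
  have h1 : ‖w.fst‖ ≤ ‖v.1.snd‖ :=
    norm_le_of_norm_apply_le (· + 1) (add_left_injective 1).injOn fun k _ => by
      rw [w1]; exact key k _
  -- The factor `√0` of creation kills the coordinate 0, where `k - 1` is truncated.
  have hz : ∀ k, (w.snd : ℕ → ℂ) k ≠ 0 → k ≠ 0 := by
    rintro k hk rfl
    exact hk (by rw [w2]; simp)
  have h2 : ‖w.snd‖ ≤ ‖v.1.fst‖ := by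
    refine norm_le_of_norm_apply_le (· - 1) (fun j hj k hk h => ?_) fun k hk => ?_
    · have := hz j hj
      have := hz k hk
      simp only at h
      omega
    · obtain ⟨k, rfl⟩ := Nat.exists_eq_succ_of_ne_zero (hz k hk)
      rw [w2, ← norm_neg]
      refine le_trans (le_of_eq (congrArg _ ?_)) (key k (v.1.fst k))
      rw [Nat.succ_eq_add_one, Nat.add_sub_cancel]
      push_cast
      ring
  refine le_of_sq_le_sq ?_ (norm_nonneg _)
  -- `D` is off-diagonal, so the components are compared crosswise.
  rw [WithLp.prod_norm_sq_eq_of_L2, WithLp.prod_norm_sq_eq_of_L2, add_comm]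
  gcongr

/-! ### Upper bound from the commutator condition -/

theorem ket_memℓp_annihilation (n : ℕ) : Memℓp (annihilation (ket n)) 2 :=
  memℓp_of_eventually_zero _ (n + 1) fun k hk => by
    simp [annihilation, ket_apply, show k + 1 ≠ n by omega]

theorem ket_memℓp_creation (n : ℕ) : Memℓp (creation (ket n)) 2 :=
  memℓp_of_eventually_zero _ (n + 2) fun k hk => by
    simp [creation, ket_apply, show k - 1 ≠ n by omega]

/-- The commutator is tested on the unit vector `(|k⟩, 0)`; coordinate `k + 1` of the second
component of the result sees only the two diagonal entries. -/
theorem norm_coeff_sub_le {θ : ℝ} (hθ : 0 < θ) {T : L2 →L[ℂ] L2}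
    (hT : CommutatorNormLEOne (dirac θ) (diagCLM T)) (k : ℕ) :
    ‖coeff T (k + 1) (k + 1) - coeff T k k‖ ≤ √(θ / (2 * ((k : ℝ) + 1))) := by
  have h0 : (WithLp.toLp 2 (ket k, (0 : L2)) : Spinor) ∈ diracDomain := by
    refine ⟨⟨ket_memℓp_annihilation k, ket_memℓp_creation k⟩, ?_, ?_⟩
    · exact memℓp_of_eventually_zero _ 0 fun j _ => by simp [annihilation]
    · exact memℓp_of_eventually_zero _ 0 fun j _ => by simp [creation]
  obtain ⟨hd, hle⟩ := hT ⟨_, h0⟩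
  set v : (dirac θ).domain := ⟨WithLp.toLp 2 (ket k, (0 : L2)), h0⟩ with hv
  set w : Spinor := dirac θ ⟨diagCLM T v, hd⟩ - diagCLM T (dirac θ v) with hw
  have hvn : ‖(v : Spinor)‖ = 1 := by
    rw [← sq_eq_sq₀ (norm_nonneg _) zero_le_one, WithLp.prod_norm_sq_eq_of_L2]
    simp [hv, norm_ket]
  have hket : (dirac θ v).snd = ((√(2 / θ) : ℂ) * (√((k : ℝ) + 1) : ℂ)) • ket (k + 1) := by
    ext j
    have e2 : ((dirac θ v).snd : ℕ → ℂ) j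
        = (√(2 / θ) : ℂ) * ((√(j : ℝ) : ℂ) * (ket k : ℕ → ℂ) (j - 1)) := rfl
    rw [e2, lp.coeFn_smul, Pi.smul_apply, smul_eq_mul, ket_apply, ket_apply]
    rcases j with _ | j
    · simp
    · by_cases h : j = k
      · simp [h]
      · simp [h]
  have hwk : (w.snd : ℕ → ℂ) (k + 1) = (√(2 / θ) : ℂ) * (√((k : ℝ) + 1) : ℂ)
      * (coeff T k k - coeff T (k + 1) (k + 1)) := by
    have e : (w.snd : ℕ → ℂ) (k + 1)
        = (√(2 / θ) : ℂ) * ((√((k + 1 : ℕ) : ℝ) : ℂ) * (T (ket k) : ℕ → ℂ) (k + 1 - 1))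
          - (T (dirac θ v).snd : ℕ → ℂ) (k + 1) := rfl
    rw [e, hket, map_smul, lp.coeFn_smul, Pi.smul_apply, smul_eq_mul, coeff, coeff,
      Nat.add_sub_cancel]
    push_cast
    ring
  have hle2 : ‖(w.snd : ℕ → ℂ) (k + 1)‖ ≤ 1 := by
    refine (lp.norm_apply_le_norm (by norm_num) _ _).trans ?_
    refine le_trans ?_ (hle.trans_eq hvn)
    refine le_of_sq_le_sq ?_ (norm_nonneg _)
    rw [WithLp.prod_norm_sq_eq_of_L2 w]
    nlinarith [sq_nonneg ‖w.fst‖]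
  rw [hwk, norm_mul, norm_mul, Complex.norm_real, Complex.norm_real,
    Real.norm_of_nonneg (Real.sqrt_nonneg _), Real.norm_of_nonneg (Real.sqrt_nonneg _),
    norm_sub_rev] at hle2
  have hp : 0 < √(2 / θ) * √((k : ℝ) + 1) := by positivity
  refine le_of_mul_le_mul_left ?_ hp
  rw [sqrt_mul_sqrt_mul_sqrt hθ]
  exact hle2

theorem norm_coeff_sub_coeff_le {θ : ℝ} (hθ : 0 < θ) {T : L2 →L[ℂ] L2}
    (hT : CommutatorNormLEOne (dirac θ) (diagCLM T)) {m n : ℕ} (hmn : m ≤ n) :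
    ‖coeff T m m - coeff T n n‖ ≤ position θ n - position θ m := by
  induction n, hmn using Nat.le_induction with
  | base => simp
  | succ n _ ih =>
    rw [position_succ]
    have h1 := norm_coeff_sub_le hθ hT n
    rw [norm_sub_rev] at h1
    have h2 := norm_sub_le_norm_sub_add_norm_sub (coeff T m m) (coeff T n n)
      (coeff T (n + 1) (n + 1))
    linarith

/-! ### The distance between eigenstates -/

theorem eigenstate_eval (m : ℕ) (a : rapidDecayAlgebra) :
    (eigenstate m).eval a = coeff a.1 m m := rfl

theorem spectralEDist_eigenstate_of_le {θ : ℝ} (hθ : 0 < θ) {m n : ℕ} (hmn : m ≤ n) :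
    spectralEDist diagRep (dirac θ) (eigenstate m) (eigenstate n)
      = ENNReal.ofReal (position θ n - position θ m) := by
  refine le_antisymm ?_ ?_
  · refine iSup_le fun a => iSup_le fun _ => iSup_le fun hc => ?_
    refine ENNReal.ofReal_le_ofReal ((Complex.re_le_norm _).trans ?_)
    exact norm_coeff_sub_coeff_le hθ hc hmn
  -- The entries `-x_k` would have the right gaps but do not decay. Adding the constant `x_n` lets
  -- them reach 0 at `k = n`, so cutting off there opens no new gap and leaves a finite matrix.
  · set c : ℕ → ℝ := fun k => if k < n then position θ n - position θ k else 0 with hcdef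
    have hc : ∀ k, n ≤ k → c k = 0 := fun k hk => if_neg (not_lt.2 hk)
    have hc' : ∀ k, k ≤ n → c k = position θ n - position θ k := by
      intro k hk
      rcases hk.lt_or_eq with h | rfl
      · exact if_pos h
      · rw [hc k le_rfl, sub_self]
    have hgap : ∀ k : ℕ, |c (k + 1) - c k| ≤ √(θ / (2 * ((k : ℝ) + 1))) := by
      intro k
      rcases lt_or_ge k n with h | h
      · rw [hc' k h.le, hc' (k + 1) h, position_succ, abs_le]
        have := Real.sqrt_nonneg (θ / (2 * ((k : ℝ) + 1)))
        constructor <;> linarith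
      · rw [hc k h, hc (k + 1) (by omega), sub_zero, abs_zero]
        exact Real.sqrt_nonneg _
    refine le_iSup_of_le ⟨diagonal n c, diagonal_mem n c⟩ (le_iSup_of_le
      (Subtype.ext (isSelfAdjoint_diagonal n c)) (le_iSup_of_le
      (commutatorNormLEOne_diagonal hθ hc hgap) (ENNReal.ofReal_le_ofReal ?_)))
    rw [eigenstate_eval, eigenstate_eval, coeff_diagonal_self hc, coeff_diagonal_self hc,
      hc' m hmn, hc n le_rfl]
    simp

theorem edist_Psi {θ : ℝ} (hθ : 0 < θ) (m n : ℕ) :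
    edist (Psi θ m) (Psi θ n) = edist (position θ m) (position θ n) := by
  wlog h : m ≤ n generalizing m n
  · rw [edist_comm, edist_comm (position θ m)]
    exact this n m (not_le.1 h).le
  change spectralEDist diagRep (dirac θ) (eigenstate m) (eigenstate n) = _
  rw [spectralEDist_eigenstate_of_le hθ h, edist_comm, edist_dist, Real.dist_eq,
    abs_of_nonneg (sub_nonneg.2 ((position_strictMono hθ).monotone h))]

/-! ### The isometric embedding and Gromov–Hausdorff convergence -/

theorem exists_eq_Psi {θ : ℝ} (p : EigenstateSpace θ) : ∃ m, p = Psi θ m := by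
  obtain ⟨φ, m, rfl⟩ := p
  exact ⟨m, rfl⟩

theorem exists_isometry {θ : ℝ} (hθ : 0 < θ) :
    ∃ f : EigenstateSpace θ → Set.Ici (0 : ℝ), Isometry f ∧
      ∀ m : ℕ, (f (Psi θ m) : ℝ) = position θ m := by
  choose i hi using exists_eq_Psi (θ := θ)
  refine ⟨fun p => ⟨position θ (i p), position_nonneg θ _⟩, fun p q => ?_, fun m => ?_⟩
  · conv_rhs => rw [hi p, hi q, edist_Psi hθ]
    rfl
  -- The chosen index of `Psi θ m` is not known to be `m`, but both indices give the same point,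
  -- hence positions at distance 0.
  · have h := edist_Psi hθ m (i (Psi θ m))
    rw [← hi, edist_self, eq_comm, edist_eq_zero] at h
    exact h.symm

/-- Take the first position beyond `y`: its index is nonzero since `x_0 = 0 ≤ y`, and the preceding
position lies within one gap below `y`. -/
theorem exists_dist_position_le {θ : ℝ} (hθ : 0 < θ) {y : ℝ} (hy : 0 ≤ y) :
    ∃ m, dist y (position θ m) ≤ √θ := by
  have hex : ∃ n, y < position θ n := ((tendsto_position_atTop hθ).eventually_gt_atTop y).exists
  classical
  have hn := Nat.find_spec hex
  obtain ⟨m, hm⟩ : ∃ m, Nat.find hex = m + 1 := Nat.exists_eq_succ_of_ne_zero fun h => by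
    rw [h, position_zero] at hn
    exact absurd hn (not_lt.2 hy)
  have hmin : position θ m ≤ y := not_lt.1 (Nat.find_min hex (by omega))
  rw [hm, position_succ] at hn
  refine ⟨m, ?_⟩
  rw [Real.dist_eq, abs_of_nonneg (sub_nonneg.2 hmin)]
  linarith [sqrt_gap_le hθ m]

theorem gromovHausdorffEDist_le {θ : ℝ} (hθ : 0 < θ) :
    gromovHausdorffEDist (EigenstateSpace θ) (Set.Ici (0 : ℝ)) ≤ ENNReal.ofReal √θ := by
  obtain ⟨f, hf, hfx⟩ := exists_isometry hθ
  -- The common space is `ℝ`. The image of `X_θ` already lies in the half-line, so only the other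
  -- inclusion costs `√θ`.
  refine iInf_le_of_le ℝ (iInf_le_of_le inferInstance (iInf_le_of_le (fun p => (f p : ℝ))
    (iInf_le_of_le Subtype.val (iInf_le_of_le (isometry_subtype_coe.comp hf)
    (iInf_le_of_le isometry_subtype_coe ?_)))))
  refine Metric.hausdorffEDist_le_of_mem_edist ?_ ?_
  · rintro _ ⟨p, rfl⟩
    exact ⟨f p, ⟨f p, rfl⟩, by simp⟩
  · rintro _ ⟨y, rfl⟩
    obtain ⟨m, hm⟩ := exists_dist_position_le hθ y.2
    refine ⟨position θ m, ⟨Psi θ m, hfx m⟩, ?_⟩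
    rw [edist_dist]
    exact ENNReal.ofReal_le_ofReal hm

end Moyal

theorem mainTheorem7 :
    (∀ θ : ℝ, 0 < θ →
      (∀ p q : Moyal.EigenstateSpace θ, edist p q ≠ ⊤ ∧ (edist p q = 0 → p = q)) ∧
      ∃ f : Moyal.EigenstateSpace θ → Set.Ici (0 : ℝ), Isometry f ∧
        ∀ m : ℕ, (f (Moyal.Psi θ m) : ℝ) = ∑ k ∈ Finset.Icc 1 m, √(θ / (2 * (k : ℝ)))) ∧
    Tendsto (fun θ : ℝ => gromovHausdorffEDist (Moyal.EigenstateSpace θ) (Set.Ici (0 : ℝ)))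
      (𝓝[>] 0) (𝓝 0) := by
  refine ⟨fun θ hθ => ⟨fun p q => ?_, Moyal.exists_isometry hθ⟩, ?_⟩
  · obtain ⟨m, rfl⟩ := Moyal.exists_eq_Psi p
    obtain ⟨n, rfl⟩ := Moyal.exists_eq_Psi q
    rw [Moyal.edist_Psi hθ]
    refine ⟨edist_ne_top _ _, fun h => ?_⟩
    rw [(Moyal.position_strictMono hθ).injective (edist_eq_zero.1 h)]
  · have h : Tendsto (fun θ : ℝ => ENNReal.ofReal √θ) (𝓝[>] 0) (𝓝 0) := by
      have h1 : Continuous fun θ : ℝ => ENNReal.ofReal √θ :=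
        ENNReal.continuous_ofReal.comp Real.continuous_sqrt
      have h2 := h1.tendsto 0
      rw [Real.sqrt_zero, ENNReal.ofReal_zero] at h2
      exact h2.mono_left nhdsWithin_le_nhds
    refine tendsto_of_tendsto_of_tendsto_of_le_of_le' tendsto_const_nhds h
      (Eventually.of_forall fun _ => zero_le) ?_
    filter_upwards [self_mem_nhdsWithin] with θ hθ
    exact Moyal.gromovHausdorffEDist_le hθ
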